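/- A \emph{matchgate} is a two-qubit operation whose matrix in the basis $|00\rangle,|01\rangle,|10\rangle,|11\rangle$ is $$\begin{pmatrix} a&0&0&b\\ 0&u&v&0\\ 0&s&t&0\\ c&0&0&d\end{pmatrix},\qquad \begin{pmatrix} a&b\\ c&d\end{pmatrix},\ \begin{pmatrix} u&v\\ s&t\end{pmatrix}\in SU(2),$$ and an $m$-qubit \emph{matchgate circuit} is a finite product of matchgates acting on nearest-neighbour qubits among $m\ge 1$ qubits arranged on a line. A function $f:\{0,1\}^n\to\{0,1\}$ is \emph{matchgate-computable with probability at least $p$} if for some $m\ge n$ there is an $m$-qubit matchgate circuit $U$ such that, for every $x\in\{0,1\}^n$, measuring the first qubit of $U|x,0^{m-n}\rangle$ in the computational basis yields the outcome $f(x)$ with probability at least $p$. Given a probability distribution $\{\pi_k\}$ on $\{1,\dots,n+1\}$ and bits $c_1,\dots,c_{n+1}$, the associated \emph{weighted majority sampling} (WMS) computation on input $x\in\{0,1\}^n$ samples $k$ with probability $\pi_k$ and outputs $x_k\oplus c_k$ if $k\le n$, and $c_{n+1}$ if $k=n+1$, where $\oplus$ is addition modulo 2. The function $f$ is \emph{WMS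 computable with probability at least $p$} if there exist such $\{\pi_k\}$ and $c$, independent of $x$, for which the output equals $f(x)$ with probability at least $p$ for every $x\in\{0,1\}^n$. Let $p\in(1/2,1]$ and let $f:\{0,1\}^n\to\{0,1\}$. Then $f$ is matchgate-computable with probability at least $p$ if and only if $f$ is WMS computable with probability at least $p$. -/

import Mathlib

/-! Bits are elements of `Fin 2`, whose addition is addition modulo 2.  An `n`-bit string is a map
`Fin n → Fin 2`; an operator on `m` qubits is a complex matrix indexed by `m`-bit strings. -/

/-- The two-qubit operator with matrix
`[a, 0, 0, b; 0, u, v, 0; 0, x, y, 0; c, 0, 0, d]` in the basis `00, 01, 10, 11`, where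
`A = [a, b; c, d]` acts on the span of `00, 11` and `B = [u, v; x, y]` on the span of `01, 10`.
The first bit of a basis string tells the two basis strings of each block apart. -/
def matchgate (A B : Matrix (Fin 2) (Fin 2) ℂ) :
    Matrix (Fin 2 × Fin 2) (Fin 2 × Fin 2) ℂ := fun r s =>
  if r.1 = r.2 then
    if s.1 = s.2 then A r.1 s.1 else 0
  else
    if s.1 = s.2 then 0 else B r.1 s.1

/-- The operator on `m` qubits that acts as the two-qubit operator `G` on the ordered pair of
(distinct) qubits `i, j` and as the identity on all other qubits. -/
def applyGate {m : ℕ} (i j : Fin m) (G : Matrix (Fin 2 × Fin 2) (Fin 2 × Fin 2) ℂ) :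
    Matrix (Fin m → Fin 2) (Fin m → Fin 2) ℂ := fun y x =>
  if ∀ l, l ≠ i → l ≠ j → y l = x l then G (y i, y j) (x i, x j) else 0

/-- The operators implemented by matchgate circuits on `m` qubits in a row: all finite products of
matchgates (with both blocks in `SU(2)`) acting on nearest-neighbour qubits. -/
def matchgateCircuits (m : ℕ) : Submonoid (Matrix (Fin m → Fin 2) (Fin m → Fin 2) ℂ) :=
  Submonoid.closure
    {U | ∃ i j : Fin m, (i : ℕ) + 1 = (j : ℕ) ∧
      ∃ A ∈ Matrix.specialUnitaryGroup (Fin 2) ℂ, ∃ B ∈ Matrix.specialUnitaryGroup (Fin 2) ℂ,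
        U = applyGate i j (matchgate A B)}

/-- The string `x` followed by `m - n` zeroes (for `n ≤ m`). -/
def padZeros {n : ℕ} (m : ℕ) (x : Fin n → Fin 2) : Fin m → Fin 2 := fun i =>
  if h : (i : ℕ) < n then x ⟨i, h⟩ else 0

/-- The state vector of the computational basis state labelled by `z`. -/
def basisState {m : ℕ} (z : Fin m → Fin 2) : (Fin m → Fin 2) → ℂ := Pi.single z 1

/-- The probability that measuring the first of `m ≥ 1` qubits of the state `ψ` in the
computational basis yields the outcome `b`. -/
noncomputable def firstQubitProb {m : ℕ} (hm : 0 < m) (ψ : (Fin m → Fin 2) → ℂ) (b : Fin 2) : ℝ :=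
  ∑ y : Fin m → Fin 2 with y ⟨0, hm⟩ = b, ‖ψ y‖ ^ 2

/-- `U` computes `f` with probability at least `p`: for every input `x`, measuring the first qubit
of `U |x, 0⟩` yields `f x` with probability at least `p`. -/
def ComputesWithProb {n m : ℕ} (hm : 0 < m) (U : Matrix (Fin m → Fin 2) (Fin m → Fin 2) ℂ)
    (f : (Fin n → Fin 2) → Fin 2) (p : ℝ) : Prop :=
  ∀ x : Fin n → Fin 2, p ≤ firstQubitProb hm (U.mulVec (basisState (padZeros m x))) (f x)

/-- `f` is matchgate-computable with probability at least `p`. -/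
def MatchgateComputable {n : ℕ} (f : (Fin n → Fin 2) → Fin 2) (p : ℝ) : Prop :=
  ∃ (m : ℕ) (_ : n ≤ m) (hm : 0 < m), ∃ U ∈ matchgateCircuits m, ComputesWithProb hm U f p

/-- The output of weighted majority sampling on the input `x` when `k` has been sampled.  The set
of integers from `1` to `n + 1` is represented by `Fin (n + 1)`, with `n + 1` as `Fin.last n`. -/
def wmsOutput {n : ℕ} (c : Fin (n + 1) → Fin 2) (x : Fin n → Fin 2) (k : Fin (n + 1)) : Fin 2 :=
  if h : (k : ℕ) < n then x ⟨k, h⟩ + c k else c (Fin.last n)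

/-- The probability that weighted majority sampling with weights `w` and bits `c` outputs `z` on
the input `x`. -/
noncomputable def wmsProb {n : ℕ} (w : Fin (n + 1) → ℝ) (c : Fin (n + 1) → Fin 2)
    (x : Fin n → Fin 2) (z : Fin 2) : ℝ :=
  ∑ k : Fin (n + 1) with wmsOutput c x k = z, w k

/-- `f` is computable by weighted majority sampling with probability at least `p`; probability
distributions on `Fin (n + 1)` are the elements of the standard simplex. -/
def WMSComputable {n : ℕ} (f : (Fin n → Fin 2) → Fin 2) (p : ℝ) : Prop :=
  ∃ w ∈ stdSimplex ℝ (Fin (n + 1)), ∃ c : Fin (n + 1) → Fin 2,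
    ∀ x : Fin n → Fin 2, p ≤ wmsProb w c x (f x)

/-! Matchgates are free-fermion gates: conjugating a linear combination of Jordan-Wigner creation
and annihilation operators by a matchgate circuit `U` gives another such combination
(`exists_modeOperator_mul_of_mem_matchgateCircuits`). If `E` annihilates the first mode, outcome 1
on input `x` has probability `‖E U|x⟩‖² = ‖U†E U|x⟩‖²`. As `U†E U` is linear in the modes, it sends
`|x⟩` to a combination of the distinct strings obtained by one flip, so this norm is a sum of terms
each depending on one bit. Using `E†` for outcome 0 yields `exists_firstQubitProb_eq`: the circuit
acts like sampling a bit or its negation.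

Padding bits are constant and merge into one index. A bit and its negation, sampled with equal
weight, contribute exactly a fair coin; discarding that part does not hurt because `p > 1/2`
(`wmsComputable_of_forall_le`). What remains is WMS.

Conversely, one matchgate mixes the first bit, or its negation, with prescribed weight into the
outcome of a circuit on the remaining qubits (`exists_matchgateCircuit_mix`); induction on `n`
builds every WMS distribution. -/

/-! ### Gate algebra and unitarity of circuits -/

/-- A sum over the strings that agree with `y` away from the positions `i` and `j`. -/
lemma sum_eq_sum_update {M : Type*} [AddCommMonoid M] {m : ℕ} {i j : Fin m} (hij : i ≠ j)
    (y : Fin m → Fin 2) (F : (Fin m → Fin 2) → M) :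
    (∑ z, if ∀ l, l ≠ i → l ≠ j → y l = z l then F z else 0) =
      ∑ r : Fin 2 × Fin 2, F (Function.update (Function.update y i r.1) j r.2) := by
  rw [← Finset.sum_filter]
  refine Finset.sum_nbij' (fun z => (z i, z j))
    (fun r => Function.update (Function.update y i r.1) j r.2) ?_ ?_ ?_ ?_ ?_
  · simp
  · intro r _
    simp only [Finset.mem_filter, Finset.mem_univ, true_and]
    intro l hi hj
    simp [hi, hj]
  · intro z hz
    simp only [Finset.mem_filter, Finset.mem_univ, true_and] at hz
    ext1 l
    by_cases hj : l = j
    · simp [hj]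
    by_cases hi : l = i
    · simp [hi, hij]
    simp [hi, hj, hz l hi hj]
  · intro r _
    simp [hij]
  · intro z hz
    simp only [Finset.mem_filter, Finset.mem_univ, true_and] at hz
    congr 1
    ext1 l
    by_cases hj : l = j
    · simp [hj]
    by_cases hi : l = i
    · simp [hi, hij]
    simp [hi, hj, hz l hi hj]

lemma applyGate_mul_apply {m : ℕ} {i j : Fin m} (hij : i ≠ j)
    (G : Matrix (Fin 2 × Fin 2) (Fin 2 × Fin 2) ℂ)
    (K : Matrix (Fin m → Fin 2) (Fin m → Fin 2) ℂ) (y x : Fin m → Fin 2) :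
    (applyGate i j G * K) y x = ∑ r : Fin 2 × Fin 2,
      G (y i, y j) r * K (Function.update (Function.update y i r.1) j r.2) x := by
  have h := sum_eq_sum_update hij y (fun z => G (y i, y j) (z i, z j) * K z x)
  simp only [Function.update_self, Function.update_of_ne hij] at h
  simp only [Matrix.mul_apply, applyGate, ite_mul, zero_mul]
  exact h

lemma applyGate_mul {m : ℕ} {i j : Fin m} (hij : i ≠ j)
    (G H : Matrix (Fin 2 × Fin 2) (Fin 2 × Fin 2) ℂ) :
    applyGate i j G * applyGate i j H = applyGate i j (G * H) := by
  ext y x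
  rw [applyGate_mul_apply hij]
  have h : ∀ r : Fin 2 × Fin 2,
      (∀ l, l ≠ i → l ≠ j → Function.update (Function.update y i r.1) j r.2 l = x l) ↔
        ∀ l, l ≠ i → l ≠ j → y l = x l := by
    intro r
    refine forall_congr' fun l => forall_congr' fun hi => forall_congr' fun hj => ?_
    simp [hi, hj]
  simp only [applyGate, h, Matrix.mul_apply]
  split_ifs <;> simp [hij]

lemma applyGate_one {m : ℕ} (i j : Fin m) :
    applyGate i j (1 : Matrix (Fin 2 × Fin 2) (Fin 2 × Fin 2) ℂ) = 1 := by
  ext y x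
  simp only [applyGate, Matrix.one_apply, Prod.mk.injEq]
  by_cases hyx : y = x
  · simp [hyx]
  · rw [if_neg hyx, ite_eq_right_iff]
    intro h
    rw [if_neg]
    rintro ⟨hi, hj⟩
    refine hyx (funext fun l => ?_)
    by_cases h1 : l = i
    · rw [h1, hi]
    by_cases h2 : l = j
    · rw [h2, hj]
    exact h l h1 h2

lemma applyGate_conjTranspose {m : ℕ} (i j : Fin m)
    (G : Matrix (Fin 2 × Fin 2) (Fin 2 × Fin 2) ℂ) :
    (applyGate i j G).conjTranspose = applyGate i j G.conjTranspose := by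
  ext y x
  simp only [applyGate, Matrix.conjTranspose_apply, eq_comm]
  split_ifs <;> simp

lemma matchgate_mul (A B C D : Matrix (Fin 2) (Fin 2) ℂ) :
    matchgate A B * matchgate C D = matchgate (A * C) (B * D) := by
  ext ⟨a, b⟩ ⟨c, d⟩
  fin_cases a <;> fin_cases b <;> fin_cases c <;> fin_cases d <;>
    simp [matchgate, Matrix.mul_apply, Fintype.sum_prod_type, Fin.sum_univ_two]

lemma matchgate_one : matchgate 1 1 = 1 := by
  ext ⟨a, b⟩ ⟨c, d⟩
  fin_cases a <;> fin_cases b <;> fin_cases c <;> fin_cases d <;> simp [matchgate]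

lemma matchgate_conjTranspose (A B : Matrix (Fin 2) (Fin 2) ℂ) :
    (matchgate A B).conjTranspose = matchgate A.conjTranspose B.conjTranspose := by
  ext ⟨a, b⟩ ⟨c, d⟩
  fin_cases a <;> fin_cases b <;> fin_cases c <;> fin_cases d <;> simp [matchgate]

lemma matchgateCircuits_le_unitaryGroup (m : ℕ) :
    matchgateCircuits m ≤ Matrix.unitaryGroup (Fin m → Fin 2) ℂ := by
  refine Submonoid.closure_le.2 ?_
  rintro U ⟨i, j, hij, A, hA, B, hB, rfl⟩
  have hne : i ≠ j := by
    rintro rfl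
    omega
  have hA' := Matrix.mem_unitaryGroup_iff.1 (Matrix.mem_specialUnitaryGroup_iff.1 hA).1
  have hB' := Matrix.mem_unitaryGroup_iff.1 (Matrix.mem_specialUnitaryGroup_iff.1 hB).1
  refine Matrix.mem_unitaryGroup_iff.2 ?_
  rw [Matrix.star_eq_conjTranspose] at hA' hB' ⊢
  rw [applyGate_conjTranspose, matchgate_conjTranspose, applyGate_mul hne, matchgate_mul, hA', hB',
    matchgate_one, applyGate_one]

/-! ### Bit flips and linear fermionic operators -/

/-- The string `x` with the bit at position `k` flipped. -/
def flipBit {m : ℕ} (x : Fin m → Fin 2) (k : Fin m) : Fin m → Fin 2 :=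
  Function.update x k (x k + 1)

lemma bit_add_one_add_one (b : Fin 2) : b + 1 + 1 = b := by
  revert b
  decide

lemma flipBit_self {m : ℕ} (x : Fin m → Fin 2) (k : Fin m) : flipBit x k k = x k + 1 := by
  simp [flipBit]

lemma flipBit_of_ne {m : ℕ} (x : Fin m → Fin 2) {k l : Fin m} (h : l ≠ k) :
    flipBit x k l = x l := by
  simp [flipBit, h]

lemma flipBit_flipBit {m : ℕ} (x : Fin m → Fin 2) (k : Fin m) :
    flipBit (flipBit x k) k = x := by
  simp [flipBit, bit_add_one_add_one]

lemma eq_flipBit_comm {m : ℕ} {x y : Fin m → Fin 2} {k : Fin m} :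
    y = flipBit x k ↔ x = flipBit y k := by
  constructor <;> rintro rfl <;> rw [flipBit_flipBit]

lemma flipBit_injective {m : ℕ} (x : Fin m → Fin 2) : Function.Injective (flipBit x) := by
  intro k l h
  by_contra hkl
  have := congrFun h k
  rw [flipBit_self, flipBit_of_ne x hkl] at this
  revert this
  generalize x k = b
  revert b
  decide

/-- The Jordan-Wigner sign: the parity of the bits of `x` before position `k`. -/
def jwSign {m : ℕ} (x : Fin m → Fin 2) (k : Fin m) : ℂ :=
  ∏ l ∈ Finset.Iio k, (-1) ^ (x l : ℕ)

lemma jwSign_flipBit {m : ℕ} (x : Fin m → Fin 2) (k : Fin m) :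
    jwSign (flipBit x k) k = jwSign x k := by
  refine Finset.prod_congr rfl fun l hl => ?_
  rw [flipBit_of_ne x (Finset.mem_Iio.1 hl).ne]

lemma norm_jwSign {m : ℕ} (x : Fin m → Fin 2) (k : Fin m) : ‖jwSign x k‖ = 1 := by
  simp [jwSign]

/-- The linear combination of the fermionic creation and annihilation operators on `m` modes (in
the Jordan-Wigner representation) in which `v k b` is the coefficient of the operator that
flips the `k`-th bit from `b` to `b + 1`. -/
def modeOperator {m : ℕ} (v : Fin m → Fin 2 → ℂ) :
    Matrix (Fin m → Fin 2) (Fin m → Fin 2) ℂ := fun y x =>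
  ∑ k, if y = flipBit x k then jwSign x k * v k (x k) else 0

lemma modeOperator_apply' {m : ℕ} (v : Fin m → Fin 2 → ℂ) (y x : Fin m → Fin 2) :
    modeOperator v y x = ∑ k, if x = flipBit y k then jwSign y k * v k (y k + 1) else 0 := by
  refine Finset.sum_congr rfl fun k _ => ?_
  by_cases h : x = flipBit y k
  · rw [if_pos h, if_pos (eq_flipBit_comm.1 h), h, jwSign_flipBit, flipBit_self]
  · rw [if_neg h, if_neg (mt eq_flipBit_comm.1 h)]

lemma sum_norm_sq_of_injective {α β : Type*} [Fintype α] [Fintype β] [DecidableEq β]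
    {g : α → β} (hg : Function.Injective g) (c : α → ℂ) :
    ∑ y, ‖∑ k, if y = g k then c k else 0‖ ^ 2 = ∑ k, ‖c k‖ ^ 2 := by
  classical
  symm
  refine Finset.sum_of_injOn g hg.injOn (by simp) ?_ ?_
  · intro y _ hy
    have : ∀ k, y ≠ g k := fun k h => hy ⟨k, by simp, h.symm⟩
    simp [this]
  · intro k _
    simp [hg.eq_iff]

lemma sum_norm_sq_modeOperator_col {m : ℕ} (v : Fin m → Fin 2 → ℂ) (x : Fin m → Fin 2) :
    ∑ y, ‖modeOperator v y x‖ ^ 2 = ∑ k, ‖v k (x k)‖ ^ 2 := by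
  simp only [modeOperator]
  rw [sum_norm_sq_of_injective (flipBit_injective x)]
  simp [norm_jwSign]

lemma sum_norm_sq_modeOperator_row {m : ℕ} (v : Fin m → Fin 2 → ℂ) (x : Fin m → Fin 2) :
    ∑ y, ‖modeOperator v x y‖ ^ 2 = ∑ k, ‖v k (x k + 1)‖ ^ 2 := by
  simp only [modeOperator_apply']
  rw [sum_norm_sq_of_injective (flipBit_injective x)]
  simp [norm_jwSign]

lemma modeOperator_mul_apply {m : ℕ} (v : Fin m → Fin 2 → ℂ)
    (M : Matrix (Fin m → Fin 2) (Fin m → Fin 2) ℂ) (y x : Fin m → Fin 2) :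
    (modeOperator v * M) y x =
      ∑ k, jwSign y k * v k (y k + 1) * M (flipBit y k) x := by
  simp only [Matrix.mul_apply, modeOperator_apply', Finset.sum_mul]
  rw [Finset.sum_comm]
  simp

lemma mul_modeOperator_apply {m : ℕ} (v : Fin m → Fin 2 → ℂ)
    (M : Matrix (Fin m → Fin 2) (Fin m → Fin 2) ℂ) (y x : Fin m → Fin 2) :
    (M * modeOperator v) y x =
      ∑ k, M y (flipBit x k) * (jwSign x k * v k (x k)) := by
  simp only [Matrix.mul_apply, modeOperator, Finset.mul_sum]
  rw [Finset.sum_comm]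
  simp

/-! ### Matchgates act linearly on the modes -/

/-- Two-qubit matchgates permute the linear combinations of creation and annihilation operators
on two modes. -/
lemma exists_matchgate_exchange {A B : Matrix (Fin 2) (Fin 2) ℂ} (hA : A.det = 1)
    (hB : B.det = 1) (v₀ v₁ : Fin 2 → ℂ) :
    ∃ w₀ w₁ : Fin 2 → ℂ, ∀ a b c d : Fin 2,
      v₀ (a + 1) * matchgate A B (a + 1, b) (c, d) +
          (-1) ^ (a : ℕ) * v₁ (b + 1) * matchgate A B (a, b + 1) (c, d) =
        matchgate A B (a, b) (c + 1, d) * w₀ c +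
          matchgate A B (a, b) (c, d + 1) * ((-1) ^ (c : ℕ) * w₁ d) := by
  rw [Matrix.det_fin_two] at hA hB
  -- The mode operator swaps the parity blocks. Its odd-to-even block is this literal matrix `L`, so
  -- `w` is read off from `P = A⁻¹ L B`. Its even-to-odd block is `-adj L`, and `B⁻¹ (-adj L) A =
  -- -adj P` because both determinants are 1; hence the same `w` serves both blocks.
  set N : Matrix (Fin 2) (Fin 2) ℂ := !![v₁ 1, v₀ 1; v₀ 0, -v₁ 0] * B with hN
  set P : Matrix (Fin 2) (Fin 2) ℂ := A.adjugate * N with hP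
  refine ⟨![P 1 0, P 0 1], ![-P 1 1, P 0 0], ?_⟩
  have e : ∀ a b, P a b = A.adjugate a 0 * (v₁ 1 * B 0 b + v₀ 1 * B 1 b) +
      A.adjugate a 1 * (v₀ 0 * B 0 b + -v₁ 0 * B 1 b) := by
    intro a b
    rw [hP, Matrix.mul_apply, Fin.sum_univ_two, hN, Matrix.mul_apply, Matrix.mul_apply,
      Fin.sum_univ_two, Fin.sum_univ_two]
    simp
  intro a b c d
  fin_cases a <;> fin_cases b <;> fin_cases c <;> fin_cases d <;>
    simp [matchgate, e, Matrix.adjugate_fin_two]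
  · linear_combination -(v₀ 1 * B 1 0 + v₁ 1 * B 0 0) * hA
  · linear_combination -(v₀ 1 * B 1 1 + v₁ 1 * B 0 1) * hA
  · linear_combination -(v₀ 1 * A 1 0 + v₁ 0 * A 0 0) * hB
  · linear_combination -(v₀ 1 * A 1 1 + v₁ 0 * A 0 1) * hB
  · linear_combination -(v₀ 0 * A 0 0 - v₁ 1 * A 1 0) * hB
  · linear_combination -(v₀ 0 * A 0 1 - v₁ 1 * A 1 1) * hB
  · linear_combination -(v₀ 0 * B 0 0 - v₁ 0 * B 1 0) * hA
  · linear_combination -(v₀ 0 * B 0 1 - v₁ 0 * B 1 1) * hA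

/-- Nearest-neighbour matchgates permute the linear combinations of creation and annihilation
operators. -/
lemma exists_modeOperator_mul_applyGate {m : ℕ} {i j : Fin m} (hij : (i : ℕ) + 1 = j)
    {A B : Matrix (Fin 2) (Fin 2) ℂ} (hA : A.det = 1) (hB : B.det = 1)
    (v : Fin m → Fin 2 → ℂ) :
    ∃ w, modeOperator v * applyGate i j (matchgate A B) =
      applyGate i j (matchgate A B) * modeOperator w := by
  have hne : i ≠ j := by
    rintro rfl
    omega
  obtain ⟨w₀, w₁, hw⟩ := exists_matchgate_exchange hA hB (v i) (v j)
  refine ⟨fun k => if k = i then w₀ else if k = j then w₁ else v k, ?_⟩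
  ext y x
  rw [modeOperator_mul_apply, mul_modeOperator_apply]
  have hcompl : ∀ F : Fin m → ℂ, ∑ k, F k = F i + F j + ∑ k ∈ ({i, j} : Finset (Fin m))ᶜ, F k := by
    intro F
    rw [← Finset.sum_pair hne, Finset.sum_add_sum_compl]
  -- The modes `i` and `j` transform between themselves by the two-mode exchange; every other mode
  -- operator commutes with the gate.
  rw [hcompl, hcompl]
  congr 1
  · have hyi : ∀ l, l ≠ i → l ≠ j → flipBit y i l = y l := fun l h _ => flipBit_of_ne y h
    have hyj : ∀ l, l ≠ i → l ≠ j → flipBit y j l = y l := fun l _ h => flipBit_of_ne y h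
    have hxi : ∀ l, l ≠ i → l ≠ j → flipBit x i l = x l := fun l h _ => flipBit_of_ne x h
    have hxj : ∀ l, l ≠ i → l ≠ j → flipBit x j l = x l := fun l _ h => flipBit_of_ne x h
    by_cases hyx : ∀ l, l ≠ i → l ≠ j → y l = x l
    · have e₁ : applyGate i j (matchgate A B) (flipBit y i) x =
          matchgate A B (y i + 1, y j) (x i, x j) := by
        rw [applyGate, if_pos fun l h h' => by rw [hyi l h h', hyx l h h'], flipBit_self,
          flipBit_of_ne y hne.symm]
      have e₂ : applyGate i j (matchgate A B) (flipBit y j) x =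
          matchgate A B (y i, y j + 1) (x i, x j) := by
        rw [applyGate, if_pos fun l h h' => by rw [hyj l h h', hyx l h h'], flipBit_self,
          flipBit_of_ne y hne]
      have e₃ : applyGate i j (matchgate A B) y (flipBit x i) =
          matchgate A B (y i, y j) (x i + 1, x j) := by
        rw [applyGate, if_pos fun l h h' => by rw [hxi l h h', hyx l h h'], flipBit_self,
          flipBit_of_ne x hne.symm]
      have e₄ : applyGate i j (matchgate A B) y (flipBit x j) =
          matchgate A B (y i, y j) (x i, x j + 1) := by
        rw [applyGate, if_pos fun l h h' => by rw [hxj l h h', hyx l h h'], flipBit_self,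
          flipBit_of_ne x hne]
      -- Adjacency is essential: the signs at `i` and `j` differ only by the bit at `i`, as in the
      -- two-mode exchange.
      have hIio : Finset.Iio j = insert i (Finset.Iio i) := by
        ext l
        simp only [Finset.mem_Iio, Finset.mem_insert, Fin.lt_def, Fin.ext_iff]
        omega
      have hj : ∀ z : Fin m → Fin 2, jwSign z j = (-1) ^ (z i : ℕ) * jwSign z i := by
        intro z
        rw [jwSign, hIio, Finset.prod_insert (by simp), jwSign]
      have hi : jwSign y i = jwSign x i := by
        refine Finset.prod_congr rfl fun l hl => ?_
        have hl' := Fin.lt_def.1 (Finset.mem_Iio.1 hl)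
        rw [hyx l (by rintro rfl; omega) (by rintro rfl; omega)]
      rw [e₁, e₂, e₃, e₄, hj, hj, hi, if_pos rfl, if_neg hne.symm, if_pos rfl]
      linear_combination jwSign x i * hw (y i) (y j) (x i) (x j)
    · have h0 : ∀ y' x' : Fin m → Fin 2, (∀ l, l ≠ i → l ≠ j → y' l = y l) →
          (∀ l, l ≠ i → l ≠ j → x' l = x l) → applyGate i j (matchgate A B) y' x' = 0 := by
        intro y' x' hy hx
        rw [applyGate, if_neg]
        exact fun h => hyx fun l hi hj => by rw [← hy l hi hj, h l hi hj, hx l hi hj]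
      have hr : ∀ z : Fin m → Fin 2, ∀ l, l ≠ i → l ≠ j → z l = z l := fun _ _ _ _ => rfl
      rw [h0 _ _ hyi (hr x), h0 _ _ hyj (hr x), h0 _ _ (hr y) hxi, h0 _ _ (hr y) hxj]
      simp
  · refine Finset.sum_congr rfl fun k hk => ?_
    simp only [Finset.mem_compl, Finset.mem_insert, Finset.mem_singleton, not_or] at hk
    obtain ⟨hki, hkj⟩ := hk
    rw [if_neg hki, if_neg hkj, applyGate, applyGate, flipBit_of_ne y (Ne.symm hki),
      flipBit_of_ne y (Ne.symm hkj), flipBit_of_ne x (Ne.symm hki), flipBit_of_ne x (Ne.symm hkj)]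
    have hiff : (∀ l, l ≠ i → l ≠ j → flipBit y k l = x l) ↔
        ∀ l, l ≠ i → l ≠ j → y l = flipBit x k l := by
      refine forall_congr' fun l => forall_congr' fun hi => forall_congr' fun hj => ?_
      by_cases hl : l = k
      · rw [hl, flipBit_self, flipBit_self]
        generalize y k = a
        generalize x k = b
        revert a b
        decide
      · rw [flipBit_of_ne y hl, flipBit_of_ne x hl]
    by_cases hyx : ∀ l, l ≠ i → l ≠ j → flipBit y k l = x l
    swap
    · rw [if_neg hyx, if_neg (mt hiff.2 hyx), mul_zero, zero_mul]
    rw [if_pos hyx, if_pos (hiff.1 hyx)]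
    have hk : y k + 1 = x k := by rw [← hyx k hki hkj, flipBit_self]
    have hl : ∀ l, l ≠ i → l ≠ j → l ≠ k → y l = x l := fun l h h' h'' => by
      rw [← hyx l h h', flipBit_of_ne y h'']
    rw [hk]
    -- To the left of the gate the sign string misses both qubits; to the right it contains both,
    -- and matchgates preserve their joint parity.
    rcases lt_or_gt_of_ne hki with hlt | hgt
    · have hs : jwSign y k = jwSign x k := by
        refine Finset.prod_congr rfl fun l h => ?_
        have h' := Fin.lt_def.1 (Finset.mem_Iio.1 h)
        have := Fin.lt_def.1 hlt
        rw [hl l (by rintro rfl; omega) (by rintro rfl; omega) (by rintro rfl; omega)]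
      rw [hs]
      ring
    · have hsub : ({i, j} : Finset (Fin m)) ⊆ Finset.Iio k := by
        have : (k : ℕ) ≠ j := fun h => hkj (Fin.ext h)
        have := Fin.lt_def.1 hgt
        intro l
        simp only [Finset.mem_insert, Finset.mem_singleton, Finset.mem_Iio, Fin.lt_def]
        rintro (rfl | rfl) <;> omega
      have hsplit : ∀ z : Fin m → Fin 2, jwSign z k =
          (∏ l ∈ Finset.Iio k \ {i, j}, (-1) ^ (z l : ℕ)) *
            ((-1) ^ (z i : ℕ) * (-1) ^ (z j : ℕ)) := by
        intro z
        rw [jwSign, ← Finset.prod_sdiff hsub, Finset.prod_pair hne]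
      have hs : ∏ l ∈ Finset.Iio k \ {i, j}, (-1 : ℂ) ^ (y l : ℕ) =
          ∏ l ∈ Finset.Iio k \ {i, j}, (-1 : ℂ) ^ (x l : ℕ) := by
        refine Finset.prod_congr rfl fun l h => ?_
        simp only [Finset.mem_sdiff, Finset.mem_Iio, Finset.mem_insert, Finset.mem_singleton,
          not_or] at h
        rw [hl l h.2.1 h.2.2 h.1.ne]
      have hpar : ∀ a b c d : Fin 2, (-1) ^ (a : ℕ) * (-1) ^ (b : ℕ) * matchgate A B (a, b) (c, d) =
          matchgate A B (a, b) (c, d) * ((-1) ^ (c : ℕ) * (-1) ^ (d : ℕ)) := by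
        intro a b c d
        fin_cases a <;> fin_cases b <;> fin_cases c <;> fin_cases d <;> simp [matchgate]
      rw [hsplit, hsplit, hs]
      linear_combination (∏ l ∈ Finset.Iio k \ {i, j}, (-1 : ℂ) ^ (x l : ℕ)) * v k (x k) *
        hpar (y i) (y j) (x i) (x j)

lemma exists_modeOperator_mul_of_mem_matchgateCircuits {m : ℕ}
    {U : Matrix (Fin m → Fin 2) (Fin m → Fin 2) ℂ} (hU : U ∈ matchgateCircuits m) :
    ∀ v, ∃ w, modeOperator v * U = U * modeOperator w := by
  induction hU using Submonoid.closure_induction with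
  | mem U h =>
    obtain ⟨i, j, hij, A, hA, B, hB, rfl⟩ := h
    exact exists_modeOperator_mul_applyGate hij (Matrix.mem_specialUnitaryGroup_iff.1 hA).2
      (Matrix.mem_specialUnitaryGroup_iff.1 hB).2
  | one => exact fun v => ⟨v, by simp⟩
  | mul U V _ _ hU hV =>
    intro v
    obtain ⟨w, hw⟩ := hU v
    obtain ⟨w', hw'⟩ := hV w
    exact ⟨w', by rw [← mul_assoc, hw, mul_assoc, hw', mul_assoc]⟩

/-! ### Outcome probabilities of a circuit -/

lemma sum_norm_sq_col_eq {α : Type*} [Fintype α] (M : Matrix α α ℂ) (x : α) :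
    ((∑ y, ‖M y x‖ ^ 2 : ℝ) : ℂ) = (M.conjTranspose * M) x x := by
  simp [Matrix.mul_apply, Complex.conj_mul']

lemma mulVec_basisState {m : ℕ} (U : Matrix (Fin m → Fin 2) (Fin m → Fin 2) ℂ)
    (x y : Fin m → Fin 2) : U.mulVec (basisState x) y = U y x := by
  simp [basisState]

/-- The annihilation operator of the first mode. -/
def annihilateFirst {m : ℕ} (hm : 0 < m) : Fin m → Fin 2 → ℂ :=
  Pi.single ⟨0, hm⟩ (Pi.single 1 1)

lemma modeOperator_annihilateFirst_mul_apply {m : ℕ} (hm : 0 < m)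
    (M : Matrix (Fin m → Fin 2) (Fin m → Fin 2) ℂ) (y x : Fin m → Fin 2) :
    (modeOperator (annihilateFirst hm) * M) y x =
      if y ⟨0, hm⟩ = 0 then M (flipBit y ⟨0, hm⟩) x else 0 := by
  rw [modeOperator_mul_apply, Finset.sum_eq_single ⟨0, hm⟩]
  · have : jwSign y ⟨0, hm⟩ = 1 := by
      refine Finset.prod_eq_one fun l hl => ?_
      exact absurd (Fin.lt_def.1 (Finset.mem_Iio.1 hl)) (by simp)
    rw [this, annihilateFirst, Pi.single_eq_same]
    generalize y ⟨0, hm⟩ = b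
    fin_cases b <;> simp
  · intro k _ hk
    simp [annihilateFirst, hk]
  · simp

lemma conjTranspose_modeOperator_annihilateFirst_mul_apply {m : ℕ} (hm : 0 < m)
    (M : Matrix (Fin m → Fin 2) (Fin m → Fin 2) ℂ) (y x : Fin m → Fin 2) :
    ((modeOperator (annihilateFirst hm)).conjTranspose * M) y x =
      if y ⟨0, hm⟩ = 1 then M (flipBit y ⟨0, hm⟩) x else 0 := by
  have h := fun z w => modeOperator_annihilateFirst_mul_apply hm 1 z w
  simp only [mul_one, Matrix.one_apply] at h
  rw [Matrix.mul_apply, Finset.sum_eq_single (flipBit y ⟨0, hm⟩)]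
  · rw [Matrix.conjTranspose_apply, h, flipBit_self, flipBit_flipBit]
    generalize y ⟨0, hm⟩ = b
    fin_cases b <;> simp
  · intro z _ hz
    have hzy : flipBit z ⟨0, hm⟩ ≠ y := fun h' => hz (eq_flipBit_comm.1 h'.symm)
    simp [Matrix.conjTranspose_apply, h, hzy]
  · simp

/-- This rewrites an outcome probability as the squared norm of the state after annihilation (`b =
0`) or creation (`b = 1`) on the first mode. -/
lemma firstQubitProb_flip {m : ℕ} (hm : 0 < m) (ψ : (Fin m → Fin 2) → ℂ) (b : Fin 2) :
    firstQubitProb hm ψ (b + 1) =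
      ∑ y, ‖if y ⟨0, hm⟩ = b then ψ (flipBit y ⟨0, hm⟩) else 0‖ ^ 2 := by
  rw [firstQubitProb, Finset.sum_filter]
  refine Finset.sum_nbij' (fun y => flipBit y ⟨0, hm⟩) (fun y => flipBit y ⟨0, hm⟩) (by simp)
    (by simp) (by simp [flipBit_flipBit]) (by simp [flipBit_flipBit]) ?_
  intro y _
  rw [flipBit_flipBit, flipBit_self]
  generalize y ⟨0, hm⟩ = a
  fin_cases a <;> fin_cases b <;> simp

/-- The outcome probabilities of a matchgate circuit are convex combinations of those of the bits
of its input and their negations. -/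
lemma exists_firstQubitProb_eq {m : ℕ} (hm : 0 < m)
    {U : Matrix (Fin m → Fin 2) (Fin m → Fin 2) ℂ} (hU : U ∈ matchgateCircuits m) :
    ∃ q : Fin m → Fin 2 → ℝ, (∀ k b, 0 ≤ q k b) ∧ (∀ x b,
      firstQubitProb hm (U.mulVec (basisState x)) b = ∑ k, q k (x k + b)) := by
  obtain ⟨w, hw⟩ := exists_modeOperator_mul_of_mem_matchgateCircuits hU (annihilateFirst hm)
  have hu := matchgateCircuits_le_unitaryGroup m hU
  have h₁ : U.conjTranspose * U = 1 := Matrix.mem_unitaryGroup_iff'.1 hu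
  have h₂ : U * U.conjTranspose = 1 := Matrix.mem_unitaryGroup_iff.1 hu
  set E := modeOperator (annihilateFirst hm) with hE
  have hW : modeOperator w = U.conjTranspose * (E * U) := by
    rw [hw, ← mul_assoc, h₁, one_mul]
  have hW' : (modeOperator w).conjTranspose = U.conjTranspose * (E.conjTranspose * U) := by
    simp [hW, mul_assoc]
  have key : ∀ F : Matrix (Fin m → Fin 2) (Fin m → Fin 2) ℂ, ∀ x,
      ∑ y, ‖(U.conjTranspose * (F * U)) y x‖ ^ 2 = ∑ y, ‖(F * U) y x‖ ^ 2 := by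
    intro F x
    apply Complex.ofReal_injective
    rw [sum_norm_sq_col_eq, sum_norm_sq_col_eq, Matrix.conjTranspose_mul,
      Matrix.conjTranspose_conjTranspose, mul_assoc, ← mul_assoc U, h₂, one_mul]
  refine ⟨fun k b => ‖w k (b + 1)‖ ^ 2, fun _ _ => by positivity, fun x b => ?_⟩
  fin_cases b
  -- Outcome 0 uses the creation operator, so the row norms of `modeOperator w` appear instead of
  -- its column norms.
  · have h := key E.conjTranspose x
    rw [← hW'] at h
    simp only [Matrix.conjTranspose_apply, norm_star, sum_norm_sq_modeOperator_row,
      hE, conjTranspose_modeOperator_annihilateFirst_mul_apply] at h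
    have h' := firstQubitProb_flip hm (U.mulVec (basisState x)) 1
    simp only [mulVec_basisState] at h'
    rw [← h'] at h
    simpa using h.symm
  · have h := key E x
    rw [← hW] at h
    simp only [sum_norm_sq_modeOperator_col,
      hE, modeOperator_annihilateFirst_mul_apply] at h
    have h' := firstQubitProb_flip hm (U.mulVec (basisState x)) 0
    simp only [mulVec_basisState] at h'
    rw [← h'] at h
    simpa [bit_add_one_add_one] using h.symm

lemma firstQubitProb_zero_add_one {m : ℕ} (hm : 0 < m)
    {U : Matrix (Fin m → Fin 2) (Fin m → Fin 2) ℂ} (hU : U ∈ matchgateCircuits m)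
    (x : Fin m → Fin 2) :
    firstQubitProb hm (U.mulVec (basisState x)) 0 +
      firstQubitProb hm (U.mulVec (basisState x)) 1 = 1 := by
  have h₁ : U.conjTranspose * U = 1 :=
    Matrix.mem_unitaryGroup_iff'.1 (matchgateCircuits_le_unitaryGroup m hU)
  have h : ∑ y, ‖U y x‖ ^ 2 = 1 := by
    apply Complex.ofReal_injective
    rw [sum_norm_sq_col_eq, h₁]
    simp
  rw [← h, firstQubitProb, firstQubitProb, ← Finset.sum_filter_add_sum_filter_not
    Finset.univ (fun y : Fin m → Fin 2 => y ⟨0, hm⟩ = 0)]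
  simp only [mulVec_basisState, Fin.ext_iff, Fin.val_zero, Fin.val_one]
  congr 2
  ext y
  simp only [Finset.mem_filter, Finset.mem_univ, true_and]
  omega

/-! ### From sampling with negations to WMS -/

/-- The bits of `x` together with the bit `0`. -/
def extendedBit {n : ℕ} (x : Fin n → Fin 2) (k : Fin (n + 1)) : Fin 2 :=
  if h : (k : ℕ) < n then x ⟨k, h⟩ else 0

lemma add_eq_iff_eq_add_bit {a b c : Fin 2} : a + c = b ↔ c = a + b := by
  revert a b c
  decide

lemma wmsOutput_eq {n : ℕ} (c : Fin (n + 1) → Fin 2) (x : Fin n → Fin 2) (k : Fin (n + 1)) :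
    wmsOutput c x k = extendedBit x k + c k := by
  rw [wmsOutput, extendedBit]
  split_ifs with h
  · rfl
  · have : k = Fin.last n := Fin.ext (by have := k.2; simp; omega)
    rw [this, zero_add]

lemma wmsProb_eq {n : ℕ} (w : Fin (n + 1) → ℝ) (c : Fin (n + 1) → Fin 2)
    (x : Fin n → Fin 2) (b : Fin 2) :
    wmsProb w c x b = ∑ k, if c k = extendedBit x k + b then w k else 0 := by
  simp only [wmsProb, Finset.sum_filter, wmsOutput_eq, add_eq_iff_eq_add_bit]

/-- Weighted sampling of the bits of the input and of their negations can be improved to weighted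
majority sampling, by cancelling the weight of a bit against that of its negation. -/
lemma wmsComputable_of_forall_le {n : ℕ} {f : (Fin n → Fin 2) → Fin 2} {p : ℝ} (hp : 1 / 2 < p)
    (q : Fin (n + 1) → Fin 2 → ℝ) (hq : ∀ k b, 0 ≤ q k b) (hsum : ∑ k, (q k 0 + q k 1) = 1)
    (hf : ∀ x, p ≤ ∑ k, q k (extendedBit x k + f x)) : WMSComputable f p := by
  set d : Fin (n + 1) → ℝ := fun k => |q k 0 - q k 1| with hd
  set c : Fin (n + 1) → Fin 2 := fun k => if q k 1 ≤ q k 0 then 0 else 1 with hc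
  set T := ∑ k, d k with hT
  have hd0 : ∀ k, 0 ≤ d k := fun k => abs_nonneg _
  have hqd : ∀ k b, q k b = min (q k 0) (q k 1) + if c k = b then d k else 0 := by
    intro k b
    rcases le_or_gt (q k 1) (q k 0) with h | h
    · have hck : c k = 0 := if_pos h
      have hdk : d k = q k 0 - q k 1 := abs_of_nonneg (by linarith)
      rw [hck, hdk, min_eq_right h]
      fin_cases b <;> simp
    · have hck : c k = 1 := if_neg h.not_ge
      have hdk : d k = q k 1 - q k 0 := by
        simp only [hd]
        rw [abs_sub_comm]
        exact abs_of_nonneg (by linarith)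
      rw [hck, hdk, min_eq_left h.le]
      fin_cases b <;> simp
  set M := ∑ k, min (q k 0) (q k 1) with hM
  have hM0 : 0 ≤ M := Finset.sum_nonneg fun k _ => le_min (hq k 0) (hq k 1)
  have hMT : 2 * M + T = 1 := by
    rw [← hsum, hM, hT, Finset.mul_sum, ← Finset.sum_add_distrib]
    refine Finset.sum_congr rfl fun k _ => ?_
    rw [hd]
    linarith [min_add_max (q k 0) (q k 1), max_sub_min_eq_abs' (q k 0) (q k 1)]
  set S : (Fin n → Fin 2) → ℝ := fun x =>
    ∑ k, if c k = extendedBit x k + f x then d k else 0 with hS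
  have hpS : ∀ x, p ≤ M + S x := by
    intro x
    rw [hM, hS, ← Finset.sum_add_distrib]
    refine (hf x).trans_eq (Finset.sum_congr rfl fun k _ => hqd _ _)
  have hST : ∀ x, S x ≤ T := by
    intro x
    refine Finset.sum_le_sum fun k _ => ?_
    split_ifs
    exacts [le_rfl, hd0 k]
  -- If `T` were 0, then `M = 1/2` would force `p ≤ 1/2`.
  have hT0 : 0 < T := by
    linarith [hpS 0, hST 0]
  refine ⟨fun k => d k / T, ⟨fun k => by positivity, ?_⟩, c, fun x => ?_⟩
  · rw [← Finset.sum_div, ← hT, div_self hT0.ne']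
  · have : wmsProb (fun k => d k / T) c x (f x) = S x / T := by
      rw [wmsProb_eq, hS, Finset.sum_div]
      refine Finset.sum_congr rfl fun k _ => ?_
      split_ifs <;> simp
    rw [this, le_div_iff₀ hT0]
    -- Since `2p ≥ 1` and `M ≥ 0`, `p T = p - 2pM ≤ p - M ≤ S x`.
    nlinarith [hpS x]

lemma wmsComputable_of_matchgateComputable {n : ℕ} {f : (Fin n → Fin 2) → Fin 2} {p : ℝ}
    (hp : 1 / 2 < p) (h : MatchgateComputable f p) : WMSComputable f p := by
  obtain ⟨m, -, hm, U, hU, hf⟩ := h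
  obtain ⟨q, hq0, hq⟩ := exists_firstQubitProb_eq hm hU
  -- All padding qubits carry the bit 0, so their weights are pooled at the constant index.
  let g : Fin m → Fin (n + 1) := fun k => ⟨min k n, by omega⟩
  have hg : ∀ x : Fin n → Fin 2, ∀ k, extendedBit x (g k) = padZeros m x k := by
    intro x k
    simp only [extendedBit, padZeros, g]
    by_cases h : (k : ℕ) < n
    · have : min (k : ℕ) n < n := by omega
      simp [h, h.le]
    · simp [h]
  have hsum : ∀ F : Fin m → ℝ, ∑ κ, ∑ k with g k = κ, F k = ∑ k, F k :=
    fun F => Finset.sum_fiberwise _ _ _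
  refine wmsComputable_of_forall_le hp (fun κ b => ∑ k with g k = κ, q k b)
    (fun κ b => Finset.sum_nonneg fun k _ => hq0 k b) ?_ fun x => ?_
  · simp only [← Finset.sum_add_distrib]
    -- On the all-zero input, the two outcome probabilities add up to the total weight.
    rw [hsum, ← firstQubitProb_zero_add_one hm hU 0, hq, hq, ← Finset.sum_add_distrib]
    simp
  · refine (hf x).trans_eq ?_
    rw [hq, ← hsum]
    refine Finset.sum_congr rfl fun κ _ => Finset.sum_congr rfl fun k hk => ?_
    rw [← hg, (Finset.mem_filter.1 hk).2]

/-! ### Building circuits for WMS -/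

lemma sum_bitString_succ {M : Type*} [AddCommMonoid M] {m : ℕ} (F : (Fin (m + 1) → Fin 2) → M) :
    ∑ y, F y = ∑ a : Fin 2, ∑ z : Fin m → Fin 2, F (Fin.cons a z) := by
  rw [← Fintype.sum_prod_type']
  exact (Fintype.sum_equiv (Fin.consEquiv fun _ => Fin 2) _ _ fun _ => rfl).symm

/-- The operator that acts as `M` on all qubits but the first. -/
def tailOperator {m : ℕ} (M : Matrix (Fin m → Fin 2) (Fin m → Fin 2) ℂ) :
    Matrix (Fin (m + 1) → Fin 2) (Fin (m + 1) → Fin 2) ℂ := fun y x =>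
  if y 0 = x 0 then M (Fin.tail y) (Fin.tail x) else 0

lemma tailOperator_one {m : ℕ} :
    tailOperator (1 : Matrix (Fin m → Fin 2) (Fin m → Fin 2) ℂ) = 1 := by
  ext y x
  induction y using Fin.consCases with | cons a y => ?_
  induction x using Fin.consCases with | cons b x => ?_
  simp only [tailOperator, Matrix.one_apply, Fin.cons_zero, Fin.tail_cons, Fin.cons_inj]
  split_ifs <;> simp_all

lemma tailOperator_mul {m : ℕ} (M N : Matrix (Fin m → Fin 2) (Fin m → Fin 2) ℂ) :
    tailOperator (M * N) = tailOperator M * tailOperator N := by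
  ext y x
  simp only [tailOperator, Matrix.mul_apply, sum_bitString_succ, Fin.cons_zero, Fin.tail_cons]
  generalize y 0 = a
  generalize x 0 = b
  fin_cases a <;> fin_cases b <;> simp

lemma tailOperator_applyGate {m : ℕ} (i j : Fin m)
    (G : Matrix (Fin 2 × Fin 2) (Fin 2 × Fin 2) ℂ) :
    tailOperator (applyGate i j G) = applyGate i.succ j.succ G := by
  ext y x
  have h : (∀ l, l ≠ i.succ → l ≠ j.succ → y l = x l) ↔
      y 0 = x 0 ∧ ∀ l, l ≠ i → l ≠ j → Fin.tail y l = Fin.tail x l := by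
    simp [Fin.forall_fin_succ, Fin.tail, (Fin.succ_ne_zero _).symm]
  simp only [tailOperator, applyGate, h, ite_and]
  rfl

lemma tailOperator_mem_matchgateCircuits {m : ℕ}
    {U : Matrix (Fin m → Fin 2) (Fin m → Fin 2) ℂ} (hU : U ∈ matchgateCircuits m) :
    tailOperator U ∈ matchgateCircuits (m + 1) := by
  induction hU using Submonoid.closure_induction with
  | mem U h =>
    obtain ⟨i, j, hij, A, hA, B, hB, rfl⟩ := h
    exact Submonoid.subset_closure
      ⟨i.succ, j.succ, by simp [← hij], A, hA, B, hB, tailOperator_applyGate i j _⟩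
  | one => rw [tailOperator_one]; exact one_mem _
  | mul U V _ _ hU hV => rw [tailOperator_mul]; exact mul_mem hU hV

lemma firstQubitProb_succ {m : ℕ} (hm : 0 < m + 1) (ψ : (Fin (m + 1) → Fin 2) → ℂ) (b : Fin 2) :
    firstQubitProb hm ψ b = ∑ z : Fin m → Fin 2, ‖ψ (Fin.cons b z)‖ ^ 2 := by
  rw [firstQubitProb, Finset.sum_filter, sum_bitString_succ]
  have : ∀ (a : Fin 2) (z : Fin m → Fin 2),
      (Fin.cons a z : Fin (m + 1) → Fin 2) ⟨0, hm⟩ = a := fun a z => Fin.cons_zero _ _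
  simp only [this]
  fin_cases b <;> simp

/-- No interference occurs: the first qubit enters the gate in the basis state `x 0`, so each final
string receives amplitude from only one value of the second qubit, and that value selects the block.
-/
lemma firstQubitProb_applyGate_mul_tailOperator {m : ℕ} (A B : Matrix (Fin 2) (Fin 2) ℂ)
    (V : Matrix (Fin (m + 1) → Fin 2) (Fin (m + 1) → Fin 2) ℂ) (x : Fin (m + 2) → Fin 2)
    (b : Fin 2) :
    firstQubitProb (Nat.succ_pos (m + 1))
        ((applyGate 0 1 (matchgate A B) * tailOperator V).mulVec (basisState x)) b =
      ‖A b (x 0)‖ ^ 2 *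
          firstQubitProb (Nat.succ_pos m) (V.mulVec (basisState (Fin.tail x))) (x 0) +
        ‖B b (x 0)‖ ^ 2 *
          firstQubitProb (Nat.succ_pos m) (V.mulVec (basisState (Fin.tail x))) (x 0 + 1) := by
  have hu : ∀ (a c a' c' : Fin 2) (z : Fin m → Fin 2),
      Function.update (Function.update (Fin.cons a (Fin.cons c z) : Fin (m + 2) → Fin 2) 0 a') 1 c'
        = Fin.cons a' (Fin.cons c' z) := by
    intro a c a' c' z
    rw [Fin.update_cons_zero, ← Fin.succ_zero_eq_one, ← Fin.cons_update, Fin.update_cons_zero]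
  have h1 : ∀ (a c : Fin 2) (z : Fin m → Fin 2),
      (Fin.cons a (Fin.cons c z) : Fin (m + 2) → Fin 2) 1 = c := fun _ _ _ => rfl
  obtain ⟨F, hF⟩ : ∃ F : Fin 2 → (Fin m → Fin 2) → ℂ, ∀ t z,
      V (Fin.cons t z) (Fin.tail x) = F t z := ⟨_, fun _ _ => rfl⟩
  rw [firstQubitProb_succ, firstQubitProb_succ, firstQubitProb_succ, sum_bitString_succ]
  simp only [mulVec_basisState, applyGate_mul_apply (i := (0 : Fin (m + 2))) (j := 1) zero_ne_one, hu,
    tailOperator, Fin.cons_zero, Fin.tail_cons, h1, hF, Fintype.sum_prod_type, Fin.sum_univ_two]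
  generalize x 0 = a
  fin_cases a <;> fin_cases b <;>
    simp [matchgate, mul_pow, Finset.mul_sum, add_comm]
  exact add_comm _ _

lemma exists_specialUnitary_norm_sq {s : ℝ} (h0 : 0 ≤ s) (h1 : s ≤ 1) :
    ∃ A ∈ Matrix.specialUnitaryGroup (Fin 2) ℂ,
      ∀ a b, ‖A a b‖ ^ 2 = if a = b then s else 1 - s := by
  have e₁ : ((√s : ℝ) : ℂ) * (√s : ℝ) = s := by
    rw [← Complex.ofReal_mul, Real.mul_self_sqrt h0]
  have e₂ : ((√(1 - s) : ℝ) : ℂ) * (√(1 - s) : ℝ) = 1 - s := by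
    rw [← Complex.ofReal_mul, Real.mul_self_sqrt (by linarith)]
    simp
  refine ⟨!![(√s : ℝ), -(√(1 - s) : ℝ); (√(1 - s) : ℝ), (√s : ℝ)],
    Matrix.mem_specialUnitaryGroup_iff.2 ⟨Matrix.mem_unitaryGroup_iff.2 ?_, ?_⟩, ?_⟩
  · rw [Matrix.star_eq_conjTranspose]
    ext a b
    fin_cases a <;> fin_cases b <;>
      simp [Matrix.mul_apply, Fin.sum_univ_two, e₁, e₂, mul_comm]
  · rw [Matrix.det_fin_two_of]
    linear_combination e₁ + e₂
  · intro a b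
    fin_cases a <;> fin_cases b <;>
      simp [Real.sq_sqrt h0, Real.sq_sqrt (sub_nonneg.2 h1)]

/-- One matchgate suffices to mix the first bit or its negation into the outcome of a circuit on
the other qubits. -/
lemma exists_matchgateCircuit_mix {m : ℕ}
    {V : Matrix (Fin (m + 1) → Fin 2) (Fin (m + 1) → Fin 2) ℂ}
    (hV : V ∈ matchgateCircuits (m + 1)) {s : ℝ} (h0 : 0 ≤ s) (h1 : s ≤ 1) (c : Fin 2) :
    ∃ U ∈ matchgateCircuits (m + 2), ∀ x b,
      firstQubitProb (Nat.succ_pos (m + 1)) (U.mulVec (basisState x)) b =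
        s * (if c = x 0 + b then 1 else 0) + (1 - s) *
          firstQubitProb (Nat.succ_pos m) (V.mulVec (basisState (Fin.tail x))) b := by
  have key : ∀ α β : ℝ, 0 ≤ α → α ≤ 1 → 0 ≤ β → β ≤ 1 → ∃ U ∈ matchgateCircuits (m + 2), ∀ x b,
      firstQubitProb (Nat.succ_pos (m + 1)) (U.mulVec (basisState x)) b =
        (if b = x 0 then α else 1 - α) *
          firstQubitProb (Nat.succ_pos m) (V.mulVec (basisState (Fin.tail x))) (x 0) +
        (if b = x 0 then β else 1 - β) *
          firstQubitProb (Nat.succ_pos m) (V.mulVec (basisState (Fin.tail x))) (x 0 + 1) := by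
    intro α β hα hα' hβ hβ'
    obtain ⟨A, hA, hA'⟩ := exists_specialUnitary_norm_sq hα hα'
    obtain ⟨B, hB, hB'⟩ := exists_specialUnitary_norm_sq hβ hβ'
    refine ⟨applyGate 0 1 (matchgate A B) * tailOperator V,
      mul_mem (Submonoid.subset_closure ⟨0, 1, by simp, A, hA, B, hB, rfl⟩)
        (tailOperator_mem_matchgateCircuits hV), fun x b => ?_⟩
    rw [firstQubitProb_applyGate_mul_tailOperator, hA', hB']
  have htot := fun x => firstQubitProb_zero_add_one (Nat.succ_pos m) hV x
  fin_cases c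
  -- When the tail outcome agrees with `x 0`, it is kept; otherwise `x 0` wins with probability `s`.
  · obtain ⟨U, hU, h⟩ := key 1 s zero_le_one le_rfl h0 h1
    refine ⟨U, hU, fun x b => ?_⟩
    rw [h]
    have := htot (Fin.tail x)
    generalize x 0 = a
    fin_cases a <;> fin_cases b <;> simp <;> linear_combination s * this
  -- When the tail outcome is the negation of `x 0`, it is kept; otherwise the negation wins with
  -- probability `s`.
  · obtain ⟨U, hU, h⟩ := key (1 - s) 0 (by linarith) (by linarith) le_rfl zero_le_one
    refine ⟨U, hU, fun x b => ?_⟩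
    rw [h]
    have := htot (Fin.tail x)
    generalize x 0 = a
    fin_cases a <;> fin_cases b <;> simp <;> linear_combination s * this

lemma tail_padZeros {n m : ℕ} (x : Fin (n + 1) → Fin 2) :
    Fin.tail (padZeros (m + 1) x) = padZeros m (Fin.tail x) := by
  ext1 k
  simp [padZeros, Fin.tail]

lemma exists_matchgateCircuit_wmsProb (n : ℕ) :
    ∀ w ∈ stdSimplex ℝ (Fin (n + 1)), ∀ c : Fin (n + 1) → Fin 2,
      ∃ U ∈ matchgateCircuits (n + 2), ∀ (x : Fin n → Fin 2) (b : Fin 2),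
        firstQubitProb (Nat.succ_pos (n + 1)) (U.mulVec (basisState (padZeros (n + 2) x))) b =
          wmsProb w c x b := by
  induction n with
  | zero =>
    rintro w ⟨-, hw⟩ c
    -- The constant output is a padding 0, possibly negated, mixed in with full weight; the second
    -- padding qubit only serves as partner for the gate.
    obtain ⟨U, hU, h⟩ := exists_matchgateCircuit_mix (one_mem (matchgateCircuits 1))
      zero_le_one le_rfl (c 0)
    refine ⟨U, hU, fun x b => ?_⟩
    rw [h, wmsProb_eq]
    have hw0 : w 0 = 1 := by simpa using hw
    simp [padZeros, extendedBit, hw0]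
  | succ n ih =>
    rintro w ⟨hw0, hw⟩ c
    rw [Fin.sum_univ_succ] at hw
    have hrest : 0 ≤ ∑ k : Fin (n + 1), w k.succ := Finset.sum_nonneg fun k _ => hw0 _
    obtain ⟨w', hw', hww'⟩ : ∃ w' ∈ stdSimplex ℝ (Fin (n + 1)),
        ∀ k, w k.succ = (1 - w 0) * w' k := by
      -- The remaining weights are renormalised; if they all vanish, any distribution will do.
      by_cases hone : w 0 = 1
      · refine ⟨Pi.single 0 1, single_mem_stdSimplex ℝ 0, fun k => ?_⟩
        have hz : ∑ k : Fin (n + 1), w k.succ = 0 := by linarith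
        rw [(Finset.sum_eq_zero_iff_of_nonneg fun k _ => hw0 _).1 hz k (Finset.mem_univ k), hone]
        simp
      · have hpos : 0 < 1 - w 0 := lt_of_le_of_ne (by linarith) fun h => hone (by linarith)
        refine ⟨fun k => w k.succ / (1 - w 0), ⟨fun k => div_nonneg (hw0 _) hpos.le, ?_⟩,
          fun k => ?_⟩
        · rw [← Finset.sum_div, div_eq_one_iff_eq hpos.ne']
          linarith
        · field_simp
    obtain ⟨V, hV, hVp⟩ := ih w' hw' (Fin.tail c)
    obtain ⟨U, hU, h⟩ := exists_matchgateCircuit_mix hV (hw0 0) (by linarith) (c 0)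
    refine ⟨U, hU, fun x b => ?_⟩
    have hx0 : padZeros (n + 1 + 2) x 0 = extendedBit x 0 := by
      simp [padZeros, extendedBit]
    have hxs : ∀ k : Fin (n + 1), extendedBit x k.succ = extendedBit (Fin.tail x) k := by
      intro k
      simp [extendedBit, Fin.tail]
    rw [h, tail_padZeros, hVp, wmsProb_eq, wmsProb_eq, Finset.mul_sum, hx0, Fin.sum_univ_succ (n := n + 1)]
    congr 1
    · split_ifs <;> simp
    · refine Finset.sum_congr rfl fun k _ => ?_
      rw [hxs, hww', Fin.tail]
      split_ifs <;> simp

lemma matchgateComputable_of_wmsComputable {n : ℕ} {f : (Fin n → Fin 2) → Fin 2} {p : ℝ}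
    (h : WMSComputable f p) : MatchgateComputable f p := by
  obtain ⟨w, hw, c, hf⟩ := h
  obtain ⟨U, hU, hp⟩ := exists_matchgateCircuit_wmsProb n w hw c
  exact ⟨n + 2, by omega, Nat.succ_pos _, U, hU, fun x => (hf x).trans_eq (hp x (f x)).symm⟩

theorem mainTheorem6 (n : ℕ) (f : (Fin n → Fin 2) → Fin 2) (p : ℝ)
    (hp : 1 / 2 < p) (hp1 : p ≤ 1) :
    MatchgateComputable f p ↔ WMSComputable f p :=
  ⟨wmsComputable_of_matchgateComputable hp, matchgateComputable_of_wmsComputable⟩
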